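/- Let $n\ge 2$, $s\in(0,1)$ and $C(s)\ge 1$. For a domain $G\subsetneq\mathbb{R}^n$ let $\mathcal{H}^+(G)$ be the set of positive harmonic functions on $G$, and let $$h_G(x,y)=\sup_{u\in\mathcal{H}^+(G)}\left|\log\frac{u(x)}{u(y)}\right|,\qquad k_G(x,y)=\inf_\gamma\int_\gamma\frac{|dz|}{d(z,\partial G)},\qquad x,y\in G,$$ be the Harnack metric and the quasihyperbolic metric, where $\gamma$ runs over the rectifiable curves in $G$ joining $x$ and $y$. Suppose that $C(s)$ is a Harnack constant for $G$, that is, every $u\in\mathcal{H}^+(G)$ satisfies $$\max_{\overline{B}^n(z,sr)}u\le C(s)\min_{\overline{B}^n(z,sr)}u\qquad\text{whenever } r>0 \text{ and } B^n(z,r)\subset G.$$ (i) If $G$ is a proper subdomain of $\mathbb{R}^n$, then for all $x,y\in G$ $$h_G(x,y)\le\left(1+\frac{k_G(x,y)}{2\log(1+s)}\right)\log C(s).$$ (ii) If $G$ is the unit ball $\mathbb{B}^n$ or the half-space $\mathbb{H}^n=\{x\in\mathbb{R}^n: x_n>0\}$, then for all $x,y\in G$ $$h_G(x,y)\le\left(1+\frac{\rho_G(x,y)}{\log\frac{1+s}{1-s}}\right)\log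 C(s),$$ where $\rho_G$ is the hyperbolic metric, given by $\cosh\rho_{\mathbb{H}^n}(x,y)=1+\frac{|x-y|^2}{2x_ny_n}$ and $\sinh^2\frac{\rho_{\mathbb{B}^n}(x,y)}{2}=\frac{|x-y|^2}{(1-|x|^2)(1-|y|^2)}$. -/

import Mathlib

open scoped ENNReal

namespace HarnackMetric

noncomputable section

/-- A proper subdomain of `ℝⁿ`: a nonempty, open, connected set different from `ℝⁿ`. -/
def IsProperSubdomain {n : ℕ} (G : Set (EuclideanSpace ℝ (Fin n))) : Prop :=
  IsOpen G ∧ IsConnected G ∧ G ≠ Set.univ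

/-- The distance `d_G(x) = d(x, ∂G)` to the boundary. -/
def bdryDist {n : ℕ} (G : Set (EuclideanSpace ℝ (Fin n))) (x : EuclideanSpace ℝ (Fin n)) : ℝ :=
  Metric.infDist x (frontier G)

/-- The class `𝓗⁺(G)` of positive harmonic functions in `G` (for open `G`); only the values on `G`
matter. -/
def IsPositiveHarmonicOn {n : ℕ} (G : Set (EuclideanSpace ℝ (Fin n)))
    (u : EuclideanSpace ℝ (Fin n) → ℝ) : Prop :=
  InnerProductSpace.HarmonicOnNhd u G ∧ ∀ x ∈ G, 0 < u x

/-- The `(s, C)`-Harnack inequality in `G`: `u` is continuous and nonnegative on `G`, and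
`max u ≤ C * min u` on the closed ball of radius `s * r` around `x` whenever the open ball
`B(x, r)` lies in `G`. The supremum and infimum below are attained, by continuity and
compactness. -/
def SatisfiesHarnack {n : ℕ} (G : Set (EuclideanSpace ℝ (Fin n))) (s C : ℝ)
    (u : EuclideanSpace ℝ (Fin n) → ℝ) : Prop :=
  ContinuousOn u G ∧ (∀ x ∈ G, 0 ≤ u x) ∧
    ∀ (x : EuclideanSpace ℝ (Fin n)) (r : ℝ), 0 < r → Metric.ball x r ⊆ G →
      sSup (u '' Metric.closedBall x (s * r)) ≤ C * sInf (u '' Metric.closedBall x (s * r))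

/-- The Harnack (pseudo)metric `h_G(x, y) = sup |log (u x / u y)|`, the supremum over all positive
harmonic functions in `G`, taken in `[0, ∞]`. -/
def harnackDist {n : ℕ} (G : Set (EuclideanSpace ℝ (Fin n)))
    (x y : EuclideanSpace ℝ (Fin n)) : ℝ≥0∞ :=
  ⨆ (u : EuclideanSpace ℝ (Fin n) → ℝ) (_ : IsPositiveHarmonicOn G u),
    ENNReal.ofReal |Real.log (u x / u y)|

/-- The length `ℓ(γ)` of a curve, as an extended number. -/
def curveLength {n : ℕ} {x y : EuclideanSpace ℝ (Fin n)} (γ : Path x y) : ℝ≥0∞ :=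
  eVariationOn γ Set.univ

/-- The line integral `∫_γ w |dx|` of a weight `w ≥ 0` along a rectifiable curve `γ`, i.e. the
integral over `[0, ℓ(γ)]` of `w` along the arc-length parametrization of `γ`. -/
def lineIntegral {n : ℕ} (w : EuclideanSpace ℝ (Fin n) → ℝ≥0∞) {x y : EuclideanSpace ℝ (Fin n)}
    (γ : Path x y) : ℝ≥0∞ :=
  ∫⁻ t in Set.Icc (0 : ℝ) (curveLength γ).toReal, w (naturalParameterization γ Set.univ 0 t)

/-- The quasihyperbolic distance `k_G(x, y)`: the infimum of `∫_γ |dx| / d_G` over all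
rectifiable curves `γ` joining `x` and `y` in `G`. -/
def quasihypDist {n : ℕ} (G : Set (EuclideanSpace ℝ (Fin n)))
    (x y : EuclideanSpace ℝ (Fin n)) : ℝ≥0∞ :=
  ⨅ (γ : Path x y) (_ : Set.range γ ⊆ G) (_ : curveLength γ ≠ ⊤),
    lineIntegral (fun z => (ENNReal.ofReal (bdryDist G z))⁻¹) γ

/-- The unit ball `𝔹ⁿ`. -/
def unitBall (n : ℕ) : Set (EuclideanSpace ℝ (Fin n)) := Metric.ball 0 1

/-- The half-space `ℍⁿ = {x : x_n > 0}` (the last coordinate has index `n - 1`). -/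
def halfSpace (n : ℕ) (hn : 2 ≤ n) : Set (EuclideanSpace ℝ (Fin n)) :=
  {x | 0 < x ⟨n - 1, by omega⟩}

/-- The hyperbolic distance of `𝔹ⁿ`:
`sinh² (ρ/2) = |x - y|² / ((1 - |x|²) (1 - |y|²))`, for `x, y ∈ 𝔹ⁿ`. -/
def hypDistBall {n : ℕ} (x y : EuclideanSpace ℝ (Fin n)) : ℝ :=
  2 * Real.arsinh (‖x - y‖ / √((1 - ‖x‖ ^ 2) * (1 - ‖y‖ ^ 2)))

/-- The hyperbolic distance of `ℍⁿ`:
`cosh ρ = 1 + |x - y|² / (2 x_n y_n)`, for `x, y ∈ ℍⁿ`. -/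
def hypDistHalfSpace {n : ℕ} (hn : 2 ≤ n) (x y : EuclideanSpace ℝ (Fin n)) : ℝ :=
  Real.arcosh (1 + ‖x - y‖ ^ 2 / (2 * x ⟨n - 1, by omega⟩ * y ⟨n - 1, by omega⟩))

end

end HarnackMetric

/-!
Write `V = log ∘ u`. Each of the two distances `d` splits between any two points at any prescribed
value, so a chain of `⌊d x y / (2 * r)⌋₊ + 1` steps of size at most `2 * r` leads from `x` to `y`,
and `r` is chosen so that both halves of a step lie in one closed ball of the Harnack inequality,
concentric with a ball of `G` and `s` times as large. Each step then changes `V` by at most `log C`.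

Along a curve parametrized by arc length, `d` is the integral of `1 / d(z, ∂G)`. Since the distance
to the boundary is `1`-Lipschitz, a piece with integral at most `r = log (1 + s)` stays within
`s * d(m, ∂G)` of its endpoint `m`.

The unit ball and the half-space are treated together, as the sets where a quadratic polynomial with
scalar Hessian is positive. There a hyperbolic ball of radius `r = artanh s` is a Euclidean ball,
and the concentric ball that is `1 / tanh r = 1 / s` times as large is still contained in `G`.
-/

namespace HarnackMetric

open Set Metric MeasureTheory

open scoped InnerProductSpace

section GeodesicDist

variable {X Y : Type*} [PseudoMetricSpace Y] {G : Set X} {d : X → X → ℝ} {V : X → Y} {r c : ℝ}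

/-- A nonnegative function `d` on `G × G` behaving like a geodesic distance in the only respect
relevant to chaining: between any two points of `G` there are points of `G` splitting `d x y` at
every prescribed value. -/
structure IsGeodesicDist (G : Set X) (d : X → X → ℝ) : Prop where
  nonneg : ∀ x ∈ G, ∀ y ∈ G, 0 ≤ d x y
  exists_between : ∀ x ∈ G, ∀ y ∈ G, ∀ t ∈ Icc 0 (d x y), ∃ m ∈ G, d x m = t ∧ d m y = d x y - t

theorem isGeodesicDist_comp_continuous [TopologicalSpace X] [PreconnectedSpace X] {Φ : X → ℝ}
    (hΦ : Continuous Φ) : IsGeodesicDist univ fun a b => dist (Φ a) (Φ b) where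
  nonneg _ _ _ _ := dist_nonneg
  exists_between a _ b _ t := by
    rintro ⟨ht, htd⟩
    rw [Real.dist_eq] at htd
    rcases le_total (Φ a) (Φ b) with hab | hab
    · rw [abs_of_nonpos (sub_nonpos.2 hab)] at htd
      obtain ⟨m, hm⟩ := mem_range_of_exists_le_of_exists_ge (c := Φ a + t) hΦ
        ⟨a, by linarith⟩ ⟨b, by linarith⟩
      refine ⟨m, mem_univ m, ?_, ?_⟩ <;> simp only [Real.dist_eq, hm]
      · rw [abs_of_nonpos (by linarith)]; ring
      · rw [abs_of_nonpos (by linarith), abs_of_nonpos (by linarith)]; ring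
    · rw [abs_of_nonneg (sub_nonneg.2 hab)] at htd
      obtain ⟨m, hm⟩ := mem_range_of_exists_le_of_exists_ge (c := Φ a - t) hΦ
        ⟨b, by linarith⟩ ⟨a, by linarith⟩
      refine ⟨m, mem_univ m, ?_, ?_⟩ <;> simp only [Real.dist_eq, hm]
      · rw [abs_of_nonneg (by linarith)]; ring
      · rw [abs_of_nonneg (by linarith), abs_of_nonneg (by linarith)]; ring

namespace IsGeodesicDist

theorem dist_le_succ_mul (hd : IsGeodesicDist G d)
    (hV : ∀ a ∈ G, ∀ b ∈ G, d a b ≤ r → dist (V a) (V b) ≤ c) (N : ℕ) :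
    ∀ x ∈ G, ∀ y ∈ G, d x y ≤ (N + 1) * r → dist (V x) (V y) ≤ (N + 1) * c := by
  induction N with
  | zero => simpa using hV
  | succ N ih =>
    intro x hx y hy hxy
    push_cast at hxy ⊢
    have hpos : (0 : ℝ) < N + 1 + 1 := by positivity
    have hstep : d x y / (N + 1 + 1) ≤ r := (div_le_iff₀' hpos).2 hxy
    obtain ⟨m, hm, hxm, hmy⟩ := hd.exists_between x hx y hy (d x y / (N + 1 + 1))
      ⟨div_nonneg (hd.nonneg x hx y hy) hpos.le,
        div_le_self (hd.nonneg x hx y hy) (by linarith [N.cast_nonneg (α := ℝ)])⟩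
    have hrest : d m y ≤ (N + 1) * r := calc
      d m y = (N + 1) * (d x y / (N + 1 + 1)) := by rw [hmy]; field_simp; ring
      _ ≤ (N + 1) * r := by gcongr
    calc dist (V x) (V y) ≤ dist (V x) (V m) + dist (V m) (V y) := dist_triangle _ _ _
      _ ≤ c + (N + 1) * c := add_le_add (hV x hx m hm (hxm ▸ hstep)) (ih m hm y hy hrest)
      _ = (N + 1 + 1) * c := by ring

theorem dist_le_one_add_div_mul (hd : IsGeodesicDist G d) (hr : 0 < r)
    (hV : ∀ m ∈ G, ∀ a ∈ G, ∀ b ∈ G, d a m ≤ r → d m b ≤ r → dist (V a) (V b) ≤ c)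
    {x y : X} (hx : x ∈ G) (hy : y ∈ G) :
    dist (V x) (V y) ≤ (1 + d x y / (2 * r)) * c := by
  have hstep : ∀ a ∈ G, ∀ b ∈ G, d a b ≤ 2 * r → dist (V a) (V b) ≤ c := by
    intro a ha b hb hab
    have h0 := hd.nonneg a ha b hb
    obtain ⟨m, hm, ham, hmb⟩ := hd.exists_between a ha b hb (d a b / 2) ⟨by linarith, by linarith⟩
    exact hV m hm a ha b hb (by linarith) (by linarith)
  have hc : 0 ≤ c := by
    obtain ⟨m, hm, hxm, -⟩ := hd.exists_between x hx y hy 0 ⟨le_rfl, hd.nonneg x hx y hy⟩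
    exact dist_nonneg.trans (hstep x hx m hm (by linarith))
  set N := ⌊d x y / (2 * r)⌋₊
  have hN : d x y ≤ (N + 1) * (2 * r) :=
    (div_le_iff₀ (by positivity)).1 (Nat.lt_floor_add_one _).le
  calc dist (V x) (V y) ≤ (N + 1) * c := hd.dist_le_succ_mul hstep N x hx y hy hN
    _ ≤ (1 + d x y / (2 * r)) * c := by
      rw [add_comm 1]
      gcongr
      exact Nat.floor_le (div_nonneg (hd.nonneg x hx y hy) (by positivity))

end IsGeodesicDist

end GeodesicDist

section HarnackOscillation

/-- The map `V` varies by at most `c` on each closed ball of radius `s * r` concentric with a ball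
of radius `r` contained in `G`. For `V = log ∘ u` this is the `(s, exp c)`-Harnack inequality for
`u`. -/
def HasHarnackOscillation {E Y : Type*} [PseudoMetricSpace E] [PseudoMetricSpace Y] (G : Set E)
    (s c : ℝ) (V : E → Y) : Prop :=
  ∀ z r, 0 < r → ball z r ⊆ G →
    ∀ a ∈ closedBall z (s * r), ∀ b ∈ closedBall z (s * r), dist (V a) (V b) ≤ c

variable {n : ℕ} {G : Set (EuclideanSpace ℝ (Fin n))} {s C : ℝ}
  {u : EuclideanSpace ℝ (Fin n) → ℝ}

theorem SatisfiesHarnack.le_mul_of_mem_closedBall (hH : SatisfiesHarnack G s C u) (hs : s < 1)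
    (hu : ∀ x ∈ G, 0 < u x) {z a b : EuclideanSpace ℝ (Fin n)} {r : ℝ} (hr : 0 < r)
    (hz : ball z r ⊆ G) (ha : a ∈ closedBall z (s * r)) (hb : b ∈ closedBall z (s * r)) :
    u a ≤ C * u b := by
  have hsub : closedBall z (s * r) ⊆ G :=
    (closedBall_subset_ball (mul_lt_of_lt_one_left hr hs)).trans hz
  have hK : IsCompact (u '' closedBall z (s * r)) :=
    (isCompact_closedBall z (s * r)).image_of_continuousOn (hH.1.mono hsub)
  have hsup : u a ≤ C * sInf (u '' closedBall z (s * r)) :=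
    (le_csSup hK.bddAbove (mem_image_of_mem u ha)).trans (hH.2.2 z r hr hz)
  have hInf : 0 ≤ sInf (u '' closedBall z (s * r)) :=
    Real.sInf_nonneg (forall_mem_image.2 fun w hw => (hu w (hsub hw)).le)
  have hC : 0 < C := pos_of_mul_pos_left ((hu a (hsub ha)).trans_le hsup) hInf
  exact hsup.trans (by gcongr; exact csInf_le hK.bddBelow (mem_image_of_mem u hb))

theorem SatisfiesHarnack.hasHarnackOscillation_log (hH : SatisfiesHarnack G s C u) (hs : s < 1)
    (hu : ∀ x ∈ G, 0 < u x) : HasHarnackOscillation G s (Real.log C) fun x => Real.log (u x) := by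
  intro z r hr hz
  have hsub : closedBall z (s * r) ⊆ G :=
    (closedBall_subset_ball (mul_lt_of_lt_one_left hr hs)).trans hz
  have key : ∀ p ∈ closedBall z (s * r), ∀ q ∈ closedBall z (s * r),
      Real.log (u p) - Real.log (u q) ≤ Real.log C := by
    intro p hp q hq
    have hup := hu p (hsub hp)
    have huq := hu q (hsub hq)
    rw [← Real.log_div hup.ne' huq.ne']
    exact Real.log_le_log (div_pos hup huq)
      ((div_le_iff₀ huq).2 (hH.le_mul_of_mem_closedBall hs hu hr hz hp hq))
  intro a ha b hb
  rw [Real.dist_eq]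
  exact abs_sub_le_iff.2 ⟨key a ha b hb, key b hb a ha⟩

theorem harnackDist_le_of_forall_hasHarnackOscillation (hs : s < 1)
    (hH : ∀ u, IsPositiveHarmonicOn G u → SatisfiesHarnack G s C u)
    {x y : EuclideanSpace ℝ (Fin n)} (hx : x ∈ G) (hy : y ∈ G) {K : ℝ≥0∞}
    (hK : ∀ V : EuclideanSpace ℝ (Fin n) → ℝ, HasHarnackOscillation G s (Real.log C) V →
      edist (V x) (V y) ≤ K) :
    harnackDist G x y ≤ K := by
  refine iSup₂_le fun u hu => ?_
  rw [Real.log_div (hu.2 x hx).ne' (hu.2 y hy).ne', ← Real.dist_eq, ← edist_dist]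
  exact hK _ ((hH u hu).hasHarnackOscillation_log hs hu.2)

end HarnackOscillation

theorem exists_hyperbolic_weights {R t : ℝ} (hR : 0 < R) (ht : t ∈ Icc 0 R) :
    ∃ α β : ℝ, 0 ≤ α ∧ 0 ≤ β ∧ α ^ 2 + β ^ 2 + 2 * α * β * Real.cosh R = 1 ∧
      Real.cosh t = α + β * Real.cosh R ∧ Real.cosh (R - t) = α * Real.cosh R + β := by
  have hS : 0 < Real.sinh R := Real.sinh_pos_iff.2 hR
  have hcoshR := Real.cosh_sq R
  refine ⟨Real.sinh (R - t) / Real.sinh R, Real.sinh t / Real.sinh R,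
    div_nonneg (Real.sinh_nonneg_iff.2 (sub_nonneg.2 ht.2)) hS.le,
    div_nonneg (Real.sinh_nonneg_iff.2 ht.1) hS.le, ?_, ?_, ?_⟩
  · rw [Real.sinh_sub]
    field_simp
    linear_combination Real.sinh R ^ 2 * Real.cosh_sq t - Real.sinh t ^ 2 * hcoshR
  · rw [Real.sinh_sub]
    field_simp
    ring
  · rw [Real.sinh_sub, Real.cosh_sub]
    field_simp
    linear_combination Real.sinh t * hcoshR

section GeneralizedBall

variable {E : Type*} [NormedAddCommGroup E] [InnerProductSpace ℝ E]

/-- A generalized ball of an inner product space (a round ball or an open half-space), encoded by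
the quadratic polynomial `x ↦ const + ⟪grad, x⟫ - curvature / 2 * ‖x‖ ^ 2` which is positive exactly
on it. The normalization says that this polynomial has gradient of norm `1` where it vanishes. The
radius is `1 / curvature`, and `curvature = 0` gives the half-spaces. -/
structure GeneralizedBall (E : Type*) [NormedAddCommGroup E] [InnerProductSpace ℝ E] where
  const : ℝ
  grad : E
  curvature : ℝ
  curvature_nonneg : 0 ≤ curvature
  norm_grad_sq : ‖grad‖ ^ 2 + 2 * curvature * const = 1

namespace GeneralizedBall

/-- The defining quadratic polynomial of a generalized ball. On the ball it is the reciprocal of the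
density of the hyperbolic metric. -/
noncomputable def height (B : GeneralizedBall E) (x : E) : ℝ :=
  B.const + ⟪B.grad, x⟫_ℝ - B.curvature / 2 * ‖x‖ ^ 2

/-- The generalized ball as a set. -/
def domain (B : GeneralizedBall E) : Set E := {x | 0 < B.height x}

/-- The hyperbolic distance of a generalized ball, in the form common to balls and half-spaces. -/
noncomputable def hypDist (B : GeneralizedBall E) (x y : E) : ℝ :=
  Real.arcosh (1 + ‖x - y‖ ^ 2 / (2 * B.height x * B.height y))

/-- The gradient of `height`. -/
def gradAt (B : GeneralizedBall E) (x : E) : E := B.grad - B.curvature • x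

variable {B : GeneralizedBall E} {x y z m : E}

theorem mem_domain : x ∈ B.domain ↔ 0 < B.height x := Iff.rfl

theorem hypDist_comm (B : GeneralizedBall E) (x y : E) : B.hypDist x y = B.hypDist y x := by
  rw [hypDist, hypDist, norm_sub_rev, mul_right_comm]

theorem cosh_hypDist (hx : x ∈ B.domain) (hy : y ∈ B.domain) :
    Real.cosh (B.hypDist x y) = 1 + ‖x - y‖ ^ 2 / (2 * B.height x * B.height y) := by
  have := mem_domain.1 hx
  have := mem_domain.1 hy
  exact Real.cosh_arcosh (le_add_of_nonneg_right (by positivity))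

theorem hypDist_nonneg (hx : x ∈ B.domain) (hy : y ∈ B.domain) : 0 ≤ B.hypDist x y := by
  have := mem_domain.1 hx
  have := mem_domain.1 hy
  exact Real.arcosh_nonneg (le_add_of_nonneg_right (by positivity))

theorem hypDist_self (B : GeneralizedBall E) (x : E) : B.hypDist x x = 0 := by
  simp [hypDist]

theorem norm_gradAt_sq (B : GeneralizedBall E) (x : E) :
    ‖B.gradAt x‖ ^ 2 = 1 - 2 * B.curvature * B.height x := by
  rw [gradAt, norm_sub_sq_real, inner_smul_right, norm_smul, mul_pow, Real.norm_eq_abs, sq_abs,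
    height]
  linear_combination B.norm_grad_sq

theorem height_add (B : GeneralizedBall E) (x v : E) :
    B.height (x + v) = B.height x + ⟪B.gradAt x, v⟫_ℝ - B.curvature / 2 * ‖v‖ ^ 2 := by
  rw [height, height, gradAt, norm_add_sq_real, inner_add_right, inner_sub_left,
    real_inner_smul_left]
  ring

theorem ball_height_subset_domain (hm : m ∈ B.domain) : ball m (B.height m) ⊆ B.domain := by
  intro x hx
  obtain ⟨v, rfl⟩ : ∃ v, x = m + v := ⟨x - m, (add_sub_cancel m x).symm⟩
  rw [mem_ball, dist_self_add_left] at hx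
  have hκ := B.curvature_nonneg
  have hW := mem_domain.1 hm
  have hgrad : ‖B.gradAt m‖ ≤ 1 - B.curvature * B.height m :=
    abs_le_of_sq_le_sq' (by rw [norm_gradAt_sq]; nlinarith [sq_nonneg (B.curvature * B.height m)])
      (by nlinarith [sq_nonneg ‖B.gradAt m‖, B.norm_gradAt_sq m]) |>.2
  have hinner : -((1 - B.curvature * B.height m) * ‖v‖) ≤ ⟪B.gradAt m, v⟫_ℝ :=
    (abs_le.1 ((abs_real_inner_le_norm _ _).trans
      (mul_le_mul_of_nonneg_right hgrad (norm_nonneg v)))).1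
  have hv : 0 ≤ B.curvature * ‖v‖ * (B.height m - ‖v‖ / 2) :=
    mul_nonneg (mul_nonneg hκ (norm_nonneg v)) (by linarith [norm_nonneg v])
  rw [mem_domain, height_add]
  linarith

theorem norm_smul_add_smul_add_smul_grad_sq (B : GeneralizedBall E) (x y : E) (p q γ : ℝ) :
    ‖p • x + q • y + γ • B.grad‖ ^ 2 =
      2 * (p + q + γ * B.curvature) * (p * ‖x‖ ^ 2 / 2 + q * ‖y‖ ^ 2 / 2 - γ * B.const) -
        p * q * ‖x - y‖ ^ 2 + 2 * γ * (p * B.height x + q * B.height y) + γ ^ 2 := by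
  rw [norm_add_sq_real, norm_add_sq_real, norm_sub_sq_real, height, height]
  simp only [norm_smul, mul_pow, Real.norm_eq_abs, sq_abs, inner_add_left, real_inner_smul_left,
    real_inner_smul_right, real_inner_comm _ B.grad]
  linear_combination γ ^ 2 * B.norm_grad_sq

theorem exists_norm_sub_sq_div_height_eq {p q γ : ℝ} (hμ : 0 < p + q + γ * B.curvature)
    (hγ : p * B.height x + q * B.height y = 1 - γ)
    (hpq : p * q * ‖x - y‖ ^ 2 = 1 - (1 - γ) ^ 2) :
    ∃ m ∈ B.domain, ∀ z, ‖z - m‖ ^ 2 / B.height m =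
      p * ‖z - x‖ ^ 2 + q * ‖z - y‖ ^ 2 - 2 * γ * B.height z := by
  set μ := p + q + γ * B.curvature
  set v := p • x + q • y + γ • B.grad
  set b := p * ‖x‖ ^ 2 / 2 + q * ‖y‖ ^ 2 / 2 - γ * B.const with hb
  have hnull : ‖v‖ ^ 2 = 2 * μ * b := by
    rw [norm_smul_add_smul_add_smul_grad_sq, hpq, hγ]
    ring
  have hheight : B.height (μ⁻¹ • v) = μ⁻¹ := by
    have hscaled : μ * B.const + ⟪B.grad, v⟫_ℝ - B.curvature * b = 1 := by
      simp only [v, inner_add_right, real_inner_smul_right, real_inner_self_eq_norm_sq]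
      rw [height, height] at hγ
      linear_combination hγ + γ * B.norm_grad_sq
    rw [height, norm_smul, mul_pow, hnull, real_inner_smul_right, Real.norm_eq_abs, sq_abs]
    field_simp
    linear_combination hscaled
  refine ⟨μ⁻¹ • v, by rw [mem_domain, hheight]; positivity, fun z => ?_⟩
  rw [hheight, norm_sub_sq_real, norm_smul, mul_pow, hnull, real_inner_smul_right,
    Real.norm_eq_abs, sq_abs]
  simp only [v, inner_add_right, real_inner_smul_right]
  rw [norm_sub_sq_real, norm_sub_sq_real, height, real_inner_comm z B.grad]
  field_simp
  rw [hb]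
  ring

-- Give `ℝ × E × ℝ` the Lorentzian form `((μ, v, b), (μ', v', b')) ↦ μ * b' + μ' * b - ⟪v, v'⟫`.
-- With `X = (1, x, ‖x‖ ^ 2 / 2)` on the light cone and `N = (curvature, grad, -const)`, a point `x`
-- of the ball becomes the point `X / height x - N` of a hyperboloid orthogonal to `N`, and `cosh`
-- of the hyperbolic distance becomes the form. The point `m` below is the combination of `x` and
-- `y` with coefficients `α` and `β`, which `hαβ` puts on the hyperboloid.
theorem exists_cosh_hypDist_eq {α β : ℝ} (hα : 0 ≤ α) (hβ : 0 ≤ β)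
    (hx : x ∈ B.domain) (hy : y ∈ B.domain)
    (hαβ : α ^ 2 + β ^ 2 + 2 * α * β * Real.cosh (B.hypDist x y) = 1) :
    ∃ m ∈ B.domain, ∀ z ∈ B.domain, Real.cosh (B.hypDist z m) =
      α * Real.cosh (B.hypDist z x) + β * Real.cosh (B.hypDist z y) := by
  have hsum : α + β ≤ 1 := (sq_le_one_iff₀ (add_nonneg hα hβ)).1 <| by
    nlinarith [mul_nonneg (mul_nonneg hα hβ) (sub_nonneg.2 (Real.one_le_cosh (B.hypDist x y)))]
  have hκ : 0 ≤ (1 - (α + β)) * B.curvature :=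
    mul_nonneg (sub_nonneg.2 hsum) B.curvature_nonneg
  have hx' := mem_domain.1 hx
  have hy' := mem_domain.1 hy
  rw [cosh_hypDist hx hy] at hαβ
  obtain ⟨m, hm, h⟩ := exists_norm_sub_sq_div_height_eq (B := B) (x := x) (y := y)
    (p := α / B.height x) (q := β / B.height y) (γ := 1 - (α + β))
    (by
      rcases hα.eq_or_lt with rfl | hα
      · have : 0 < β := by nlinarith
        positivity
      · positivity)
    (by field_simp; ring)
    (by rw [← hαβ]; field_simp; ring)
  refine ⟨m, hm, fun z hz => ?_⟩
  have hz' := mem_domain.1 hz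
  have hm' := mem_domain.1 hm
  rw [cosh_hypDist hz hm, cosh_hypDist hz hx, cosh_hypDist hz hy]
  calc 1 + ‖z - m‖ ^ 2 / (2 * B.height z * B.height m)
      = 1 + ‖z - m‖ ^ 2 / B.height m / (2 * B.height z) := by field_simp
    _ = α * (1 + ‖z - x‖ ^ 2 / (2 * B.height z * B.height x)) +
        β * (1 + ‖z - y‖ ^ 2 / (2 * B.height z * B.height y)) := by rw [h]; field_simp; ring

theorem isGeodesicDist_hypDist (B : GeneralizedBall E) : IsGeodesicDist B.domain B.hypDist where
  nonneg _ hx _ hy := hypDist_nonneg hx hy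
  exists_between x hx y hy t ht := by
    rcases ht.1.eq_or_lt with rfl | htpos
    · exact ⟨x, hx, B.hypDist_self x, (sub_zero _).symm⟩
    obtain ⟨α, β, hα, hβ, hαβ, hcosh_t, hcosh_sub⟩ :=
      exists_hyperbolic_weights (htpos.trans_le ht.2) ht
    obtain ⟨m, hm, h⟩ := exists_cosh_hypDist_eq hα hβ hx hy hαβ
    have hxm := h x hx
    have hym := h y hy
    rw [hypDist_self, Real.cosh_zero, mul_one] at hxm hym
    refine ⟨m, hm, Real.cosh_injOn (hypDist_nonneg hx hm) ht.1 (hxm.trans hcosh_t.symm),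
      Real.cosh_injOn (hypDist_nonneg hm hy) (sub_nonneg.2 ht.2) ?_⟩
    rw [hypDist_comm, hym, hypDist_comm, hcosh_sub]

theorem sq_mul_dist_add_smul_gradAt (B : GeneralizedBall E) (x m : E) {τ D : ℝ}
    (hD : D = 1 + B.curvature * τ) (hD0 : D ≠ 0) :
    (D * dist x (m + (τ / D) • B.gradAt m)) ^ 2 =
      D * (‖x - m‖ ^ 2 - 2 * τ * B.height x) + 2 * τ * B.height m + τ ^ 2 := by
  obtain ⟨v, rfl⟩ : ∃ v, x = m + v := ⟨x - m, (add_sub_cancel m x).symm⟩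
  rw [dist_add_left, dist_eq_norm, add_sub_cancel_left, mul_pow, norm_sub_sq_real,
    real_inner_smul_right, norm_smul, mul_pow, Real.norm_eq_abs, sq_abs, norm_gradAt_sq,
    height_add, real_inner_comm]
  field_simp
  rw [hD]
  ring

theorem norm_sub_sq_le_of_hypDist_le (hx : x ∈ B.domain) (hm : m ∈ B.domain) {r : ℝ}
    (h : B.hypDist x m ≤ r) :
    ‖x - m‖ ^ 2 ≤ 2 * ((Real.cosh r - 1) * B.height m) * B.height x := by
  have := mem_domain.1 hx
  have := mem_domain.1 hm
  have h0 := hypDist_nonneg hx hm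
  have hcosh : Real.cosh (B.hypDist x m) ≤ Real.cosh r :=
    Real.cosh_le_cosh.2 (by rwa [abs_of_nonneg h0, abs_of_nonneg (h0.trans h)])
  rw [cosh_hypDist hx hm, ← le_sub_iff_add_le', div_le_iff₀ (by positivity)] at hcosh
  linarith

-- The hyperbolic ball of radius `r` about `m` is the Euclidean `closedBall z (tanh r * R)`.
theorem exists_ball_subset_domain (hm : m ∈ B.domain) {r : ℝ} (hr : 0 ≤ r) :
    ∃ z R, 0 < R ∧ ball z R ⊆ B.domain ∧
      ∀ x ∈ B.domain, B.hypDist x m ≤ r → x ∈ closedBall z (Real.tanh r * R) := by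
  have hW := mem_domain.1 hm
  have hcosh := Real.one_le_cosh r
  obtain ⟨τ, hτ⟩ : ∃ τ, τ = (Real.cosh r - 1) * B.height m := ⟨_, rfl⟩
  have hτ0 : 0 ≤ τ := hτ ▸ mul_nonneg (sub_nonneg.2 hcosh) hW.le
  obtain ⟨D, hD⟩ : ∃ D, D = 1 + B.curvature * τ := ⟨_, rfl⟩
  have hD1 : 1 ≤ D := hD ▸ le_add_of_nonneg_right (mul_nonneg B.curvature_nonneg hτ0)
  have hD0 : 0 < D := by linarith
  have hsinh : 2 * τ * B.height m + τ ^ 2 = (Real.sinh r * B.height m) ^ 2 := by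
    rw [hτ, mul_pow (Real.sinh r), Real.sinh_sq]
    ring
  refine ⟨m + (τ / D) • B.gradAt m, Real.cosh r * B.height m / D, by positivity,
    fun x hx => ?_, fun x hx hxm => ?_⟩
  · rw [mem_ball, lt_div_iff₀' hD0, ← sq_lt_sq₀ (by positivity) (by positivity),
      B.sq_mul_dist_add_smul_gradAt x m hD hD0.ne', add_assoc, hsinh, mul_pow, mul_pow,
      Real.cosh_sq] at hx
    by_contra hneg
    refine hneg (ball_height_subset_domain hm ?_)
    rw [mem_domain, not_lt] at hneg
    rw [mem_ball, dist_eq_norm, ← sq_lt_sq₀ (by positivity) hW.le]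
    nlinarith [mul_nonneg hτ0 (neg_nonneg.2 hneg), sq_nonneg ‖x - m‖]
  · have hxm' := norm_sub_sq_le_of_hypDist_le hx hm hxm
    have hsinh0 := Real.sinh_nonneg_iff.2 hr
    have htanh : Real.tanh r * Real.cosh r = Real.sinh r := by
      rw [Real.tanh_eq_sinh_div_cosh, div_mul_cancel₀ _ (Real.cosh_pos r).ne']
    rw [mem_closedBall, ← mul_div_assoc, ← mul_assoc, htanh, le_div_iff₀' hD0,
      ← sq_le_sq₀ (by positivity) (by positivity),
      B.sq_mul_dist_add_smul_gradAt x m hD hD0.ne', add_assoc, hsinh]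
    rw [← hτ] at hxm'
    exact add_le_of_nonpos_left (mul_nonpos_of_nonneg_of_nonpos hD0.le (sub_nonpos.2 hxm'))

theorem dist_le_one_add_hypDist_div_mul (B : GeneralizedBall E) {Y : Type*} [PseudoMetricSpace Y]
    {V : E → Y} {s c : ℝ} (hs : s ∈ Ioo 0 1) (hV : HasHarnackOscillation B.domain s c V)
    (hx : x ∈ B.domain) (hy : y ∈ B.domain) :
    dist (V x) (V y) ≤ (1 + B.hypDist x y / Real.log ((1 + s) / (1 - s))) * c := by
  have hs' : s ∈ Icc (-1) 1 := ⟨by linarith [hs.1], hs.2.le⟩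
  have hlog : Real.log ((1 + s) / (1 - s)) = 2 * Real.artanh s := by
    rw [Real.artanh_eq_half_log hs']
    ring
  rw [hlog]
  refine B.isGeodesicDist_hypDist.dist_le_one_add_div_mul (Real.artanh_pos hs)
    (fun m hm a ha b hb ham hmb => ?_) hx hy
  obtain ⟨z, R, hR, hzR, hball⟩ := exists_ball_subset_domain hm (Real.artanh_pos hs).le
  rw [Real.tanh_artanh ⟨by linarith [hs.1], hs.2⟩] at hball
  exact hV z R hR hzR a (hball a ha ham) b (hball b hb (hypDist_comm B m b ▸ hmb))

/-- The open unit ball as a generalized ball, with `height x = (1 - ‖x‖ ^ 2) / 2`. -/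
noncomputable def unitBall (E : Type*) [NormedAddCommGroup E] [InnerProductSpace ℝ E] :
    GeneralizedBall E where
  const := 1 / 2
  grad := 0
  curvature := 1
  curvature_nonneg := zero_le_one
  norm_grad_sq := by norm_num

/-- The open half-space `0 < ⟪e, x⟫` as a generalized ball, with `height x = ⟪e, x⟫`. -/
def halfSpace (e : E) (he : ‖e‖ = 1) : GeneralizedBall E where
  const := 0
  grad := e
  curvature := 0
  curvature_nonneg := le_rfl
  norm_grad_sq := by rw [he]; norm_num

theorem height_unitBall (x : E) : (unitBall E).height x = (1 - ‖x‖ ^ 2) / 2 := by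
  simp only [height, unitBall, inner_zero_left]
  ring

theorem height_halfSpace {e : E} (he : ‖e‖ = 1) (x : E) : (halfSpace e he).height x = ⟪e, x⟫_ℝ := by
  simp only [height, halfSpace]
  ring

theorem domain_unitBall : (unitBall E).domain = ball (0 : E) 1 := by
  ext x
  rw [mem_domain, height_unitBall, mem_ball_zero_iff, ← sq_lt_one_iff₀ (norm_nonneg x)]
  constructor <;> intro h <;> linarith

theorem hypDist_unitBall (hx : x ∈ ball (0 : E) 1) (hy : y ∈ ball (0 : E) 1) :
    (unitBall E).hypDist x y =
      2 * Real.arsinh (‖x - y‖ / √((1 - ‖x‖ ^ 2) * (1 - ‖y‖ ^ 2))) := by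
  rw [← domain_unitBall, mem_domain, height_unitBall] at hx hy
  have hx' : 0 < 1 - ‖x‖ ^ 2 := by linarith
  have hy' : 0 < 1 - ‖y‖ ^ 2 := by linarith
  rw [hypDist, ← Real.arcosh_cosh (x := 2 * Real.arsinh _)
    (mul_nonneg zero_le_two (Real.arsinh_nonneg_iff.2 (by positivity))), Real.cosh_two_mul,
    Real.cosh_sq, Real.sinh_arsinh, div_pow, Real.sq_sqrt (by positivity), height_unitBall,
    height_unitBall]
  congr 1
  field_simp
  ring

/-- The half-space of the points of `ℝⁿ` with positive `i`-th coordinate, as a generalized ball. -/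
noncomputable def coordHalfSpace {ι : Type*} [Fintype ι] [DecidableEq ι] (i : ι) :
    GeneralizedBall (EuclideanSpace ℝ ι) :=
  halfSpace (EuclideanSpace.single i 1) (by simp)

theorem height_coordHalfSpace {ι : Type*} [Fintype ι] [DecidableEq ι] (i : ι)
    (x : EuclideanSpace ℝ ι) : (coordHalfSpace i).height x = x i := by
  simp [coordHalfSpace, height_halfSpace, EuclideanSpace.inner_single_left]

theorem domain_coordHalfSpace {n : ℕ} (hn : 2 ≤ n) :
    (coordHalfSpace (⟨n - 1, by omega⟩ : Fin n)).domain = HarnackMetric.halfSpace n hn := by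
  ext x
  rw [mem_domain, height_coordHalfSpace]
  rfl

theorem hypDist_coordHalfSpace {n : ℕ} (hn : 2 ≤ n) (x y : EuclideanSpace ℝ (Fin n)) :
    (coordHalfSpace (⟨n - 1, by omega⟩ : Fin n)).hypDist x y = hypDistHalfSpace hn x y := by
  rw [hypDist, height_coordHalfSpace, height_coordHalfSpace, hypDistHalfSpace]

end GeneralizedBall

end GeneralizedBall

section ArcLength

theorem continuous_variationOnFromTo {α E : Type*} [LinearOrder α] [TopologicalSpace α]
    [OrderTopology α] [PseudoEMetricSpace E] {f : α → E} (hf : BoundedVariationOn f univ)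
    (hc : Continuous f) (a : α) : Continuous (variationOnFromTo f univ a) := by
  refine continuous_iff_continuousAt.2 fun x => continuousAt_iff_continuous_left_right.2
    ⟨?_, hf.continuousWithinAt_variationOnFromTo_Ici hc.continuousWithinAt⟩
  have hsplit : ∀ y ∈ Iic x, variationOnFromTo f univ a y =
      variationOnFromTo f univ a x - (eVariationOn f (univ ∩ Icc y x)).toReal := by
    intro y hy
    rw [← variationOnFromTo.add hf.locallyBoundedVariationOn (mem_univ a) (mem_univ x)
      (mem_univ y), variationOnFromTo.eq_of_ge _ _ hy, sub_eq_add_neg]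
  refine ContinuousWithinAt.congr_of_mem ?_ hsplit self_mem_Iic
  refine continuousWithinAt_const.sub ?_
  rw [ContinuousWithinAt, Icc_self, eVariationOn.subsingleton _ (by simp)]
  exact (ENNReal.tendsto_toReal ENNReal.zero_ne_top).comp
    ((hf.tendsto_eVariationOn_Icc_zero_left hc.continuousWithinAt).mono_left
      (nhdsWithin_mono _ (subset_univ _)))

theorem lipschitzOnWith_of_hasUnitSpeedOn {E : Type*} [PseudoEMetricSpace E] {f : ℝ → E}
    {S : Set ℝ} (hf : HasUnitSpeedOn f S) : LipschitzOnWith 1 f S := by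
  intro a ha b hb
  wlog hab : a ≤ b generalizing a b
  · rw [edist_comm, edist_comm a]
    exact this hb ha (le_of_not_ge hab)
  calc edist (f a) (f b) ≤ eVariationOn f (S ∩ Icc a b) :=
        eVariationOn.edist_le f ⟨ha, left_mem_Icc.2 hab⟩ ⟨hb, right_mem_Icc.2 hab⟩
    _ = (1 : NNReal) * edist a b := by
        rw [hf ha hb, NNReal.coe_one, one_mul, ENNReal.coe_one, one_mul, edist_comm, edist_dist,
          Real.dist_eq, abs_of_nonneg (sub_nonneg.2 hab)]

variable {E : Type*} [MetricSpace E] {x y : E} {γ : Path x y}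

theorem variationOnFromTo_path_one (γ : Path x y) :
    variationOnFromTo γ univ 0 1 = (eVariationOn γ univ).toReal := by
  rw [variationOnFromTo.eq_of_le _ _ zero_le_one, univ_inter,
    show Icc (0 : unitInterval) 1 = univ from Icc_bot_top]

theorem naturalParameterization_variationOnFromTo (hγ : BoundedVariationOn γ univ)
    (b : unitInterval) :
    naturalParameterization γ univ 0 (variationOnFromTo γ univ 0 b) = γ b :=
  edist_eq_zero.1 (edist_naturalParameterization_eq_zero hγ.locallyBoundedVariationOn
    (mem_univ _) (mem_univ _))

theorem naturalParameterization_zero (hγ : BoundedVariationOn γ univ) :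
    naturalParameterization γ univ 0 0 = x := by
  simpa only [variationOnFromTo.self, γ.source] using naturalParameterization_variationOnFromTo hγ 0

theorem naturalParameterization_length (hγ : BoundedVariationOn γ univ) :
    naturalParameterization γ univ 0 (eVariationOn γ univ).toReal = y := by
  simpa only [variationOnFromTo_path_one, γ.target] using
    naturalParameterization_variationOnFromTo hγ 1

theorem exists_variationOnFromTo_eq (hγ : BoundedVariationOn γ univ) {t : ℝ}
    (ht : t ∈ Icc 0 (eVariationOn γ univ).toReal) : ∃ b, variationOnFromTo γ univ 0 b = t :=
  mem_range_of_exists_le_of_exists_ge (continuous_variationOnFromTo hγ γ.continuous 0)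
    ⟨0, (variationOnFromTo.self _ _ _).trans_le ht.1⟩
    ⟨1, ht.2.trans_eq (variationOnFromTo_path_one γ).symm⟩

theorem naturalParameterization_mem_range (hγ : BoundedVariationOn γ univ) {t : ℝ}
    (ht : t ∈ Icc 0 (eVariationOn γ univ).toReal) :
    naturalParameterization γ univ 0 t ∈ range γ := by
  obtain ⟨b, rfl⟩ := exists_variationOnFromTo_eq hγ ht
  exact ⟨b, (naturalParameterization_variationOnFromTo hγ b).symm⟩

theorem lipschitzOnWith_naturalParameterization (hγ : BoundedVariationOn γ univ) :
    LipschitzOnWith 1 (naturalParameterization γ univ 0) (Icc 0 (eVariationOn γ univ).toReal) :=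
  (lipschitzOnWith_of_hasUnitSpeedOn (has_unit_speed_naturalParameterization γ
    hγ.locallyBoundedVariationOn (mem_univ 0))).mono fun _ ht =>
      image_univ ▸ exists_variationOnFromTo_eq hγ ht

end ArcLength

section BoundaryDistance

variable {E : Type*} [NormedAddCommGroup E] [NormedSpace ℝ E] {G : Set E} {z : E}

theorem infDist_frontier_pos (hG : IsOpen G) (hne : G ≠ univ) (hz : z ∈ G) :
    0 < infDist z (frontier G) :=
  (isClosed_frontier.notMem_iff_infDist_pos (nonempty_frontier_iff.2 ⟨⟨z, hz⟩, hne⟩)).1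
    (disjoint_left.1 (disjoint_frontier_iff_isOpen.2 hG) · hz)

theorem ball_infDist_frontier_subset (hG : IsOpen G) (hz : z ∈ G) :
    ball z (infDist z (frontier G)) ⊆ G := by
  intro w hw
  have hradius : 0 < infDist z (frontier G) := pos_of_mem_ball hw
  refine (convex_ball z _).isPreconnected.subset_of_closure_inter_subset hG
    ⟨z, mem_ball_self hradius, hz⟩ ?_ hw
  rw [closure_eq_self_union_frontier, union_inter_distrib_right,
    disjoint_ball_infDist.symm.inter_eq, union_empty]
  exact inter_subset_left

end BoundaryDistance

section LogIntegral

variable {g : ℝ → ℝ} {a b : ℝ}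

theorem intervalIntegrable_inv_of_lipschitzWith (hg : LipschitzWith 1 g) (hpos : ∀ t, 0 < g t)
    (a b : ℝ) : IntervalIntegrable (fun t => (g t)⁻¹) volume a b :=
  (hg.continuous.inv₀ fun t => (hpos t).ne').intervalIntegrable a b

theorem log_one_add_sub_div_le_integral_inv (hg : LipschitzWith 1 g) (hpos : ∀ t, 0 < g t)
    (hab : a ≤ b) : Real.log (1 + (b - a) / g a) ≤ ∫ t in a..b, (g t)⁻¹ := by
  have hga := hpos a
  have hlog : ∫ t in a..b, (g a - a + t)⁻¹ = Real.log (1 + (b - a) / g a) := by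
    rw [intervalIntegral.integral_comp_add_left (fun t => t⁻¹), sub_add_cancel,
      integral_inv_of_pos hga (by linarith)]
    congr 1
    field_simp
    ring
  rw [← hlog]
  refine intervalIntegral.integral_mono_on hab ?_
    (intervalIntegrable_inv_of_lipschitzWith hg hpos a b) fun t ht => ?_
  · refine ContinuousOn.intervalIntegrable (ContinuousOn.inv₀ (by fun_prop) fun t ht => ?_)
    rw [uIcc_of_le hab] at ht
    linarith [ht.1]
  · have hgt : |g t - g a| ≤ t - a := by
      simpa [Real.dist_eq, abs_of_nonneg (sub_nonneg.2 ht.1)] using hg.dist_le_mul t a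
    exact inv_anti₀ (hpos t) (by linarith [(abs_le.1 hgt).2])

theorem log_one_add_dist_div_le_abs_integral_inv (hg : LipschitzWith 1 g) (hpos : ∀ t, 0 < g t)
    (a b : ℝ) : Real.log (1 + dist a b / g a) ≤ |∫ t in a..b, (g t)⁻¹| := by
  rcases le_total a b with hab | hba
  · rw [dist_comm, Real.dist_eq, abs_of_nonneg (sub_nonneg.2 hab)]
    exact (log_one_add_sub_div_le_integral_inv hg hpos hab).trans (le_abs_self _)
  · have hreflect : LipschitzWith 1 fun t => g (-t) := by
      simpa [Function.comp_def] using hg.comp LipschitzWith.id.neg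
    have h := log_one_add_sub_div_le_integral_inv hreflect (fun t => hpos (-t)) (neg_le_neg hba)
    rw [intervalIntegral.integral_comp_neg (fun t => (g t)⁻¹), neg_neg, neg_neg, neg_sub_neg] at h
    rw [Real.dist_eq, abs_of_nonneg (sub_nonneg.2 hba), intervalIntegral.integral_symm, abs_neg]
    exact h.trans (le_abs_self _)

theorem dist_le_mul_of_abs_integral_inv_le (hg : LipschitzWith 1 g) (hpos : ∀ t, 0 < g t) {s : ℝ}
    (hs : 0 < s) (h : |∫ t in a..b, (g t)⁻¹| ≤ Real.log (1 + s)) : dist a b ≤ s * g a := by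
  have hga := hpos a
  have hlog := (log_one_add_dist_div_le_abs_integral_inv hg hpos a b).trans h
  rw [Real.log_le_log_iff (by positivity) (by positivity), add_le_add_iff_left,
    div_le_iff₀ hga] at hlog
  exact hlog

theorem setLIntegral_Icc_inv_ofReal (hg : Continuous g) (hpos : ∀ t, 0 < g t) (hab : a ≤ b) :
    ∫⁻ t in Icc a b, (ENNReal.ofReal (g t))⁻¹ = ENNReal.ofReal (∫ t in a..b, (g t)⁻¹) := by
  rw [intervalIntegral.integral_of_le hab, ← integral_Icc_eq_integral_Ioc,
    ofReal_integral_eq_lintegral_ofReal (f := fun t => (g t)⁻¹)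
      ((hg.inv₀ fun t => (hpos t).ne').continuousOn.integrableOn_compact isCompact_Icc)
      (.of_forall fun t => (inv_pos.2 (hpos t)).le)]
  simp only [ENNReal.ofReal_inv_of_pos (hpos _)]

end LogIntegral

section Quasihyperbolic

/-- The quasihyperbolic distance of a set in a metric space, defined as in `quasihypDist` by
integrating the reciprocal of the distance to the boundary against arc length. -/
noncomputable def quasihypEDist {E : Type*} [MetricSpace E] (G : Set E) (x y : E) : ℝ≥0∞ :=
  ⨅ (γ : Path x y) (_ : range γ ⊆ G) (_ : eVariationOn γ univ ≠ ⊤),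
    ∫⁻ t in Icc (0 : ℝ) (eVariationOn γ univ).toReal,
      (ENNReal.ofReal (infDist (naturalParameterization γ univ 0 t) (frontier G)))⁻¹

theorem quasihypDist_eq_quasihypEDist {n : ℕ} (G : Set (EuclideanSpace ℝ (Fin n)))
    (x y : EuclideanSpace ℝ (Fin n)) : quasihypDist G x y = quasihypEDist G x y := rfl

variable {E Y : Type*} [NormedAddCommGroup E] [NormedSpace ℝ E] [PseudoMetricSpace Y] {G : Set E}
  {V : E → Y} {s c : ℝ} {x y : E}

theorem HasHarnackOscillation.dist_le_of_mem_closedBall (hV : HasHarnackOscillation G s c V)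
    (hG : IsOpen G) (hne : G ≠ univ) {z a b : E} (hz : z ∈ G)
    (ha : a ∈ closedBall z (s * infDist z (frontier G)))
    (hb : b ∈ closedBall z (s * infDist z (frontier G))) : dist (V a) (V b) ≤ c :=
  hV z _ (infDist_frontier_pos hG hne hz) (ball_infDist_frontier_subset hG hz) a ha b hb

theorem HasHarnackOscillation.dist_le_of_lipschitzWith (hV : HasHarnackOscillation G s c V)
    (hG : IsOpen G) (hne : G ≠ univ) (hs : 0 < s) {f : ℝ → E} (hf : LipschitzWith 1 f)
    (hfG : ∀ t, f t ∈ G) {L : ℝ} (hL : 0 ≤ L) :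
    dist (V (f 0)) (V (f L)) ≤
      (1 + (∫ t in 0..L, (infDist (f t) (frontier G))⁻¹) / (2 * Real.log (1 + s))) * c := by
  have hpos : ∀ t, 0 < infDist (f t) (frontier G) := fun t => infDist_frontier_pos hG hne (hfG t)
  have hg : LipschitzWith 1 fun t => infDist (f t) (frontier G) := by
    simpa [Function.comp_def] using (lipschitz_infDist_pt (frontier G)).comp hf
  have hint := intervalIntegrable_inv_of_lipschitzWith hg hpos
  set Φ : ℝ → ℝ := fun t => ∫ τ in 0..t, (infDist (f τ) (frontier G))⁻¹
  have hΦ : ∀ a b, Φ b - Φ a = ∫ τ in a..b, (infDist (f τ) (frontier G))⁻¹ := fun a b =>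
    intervalIntegral.integral_interval_sub_left (hint _ _) (hint _ _)
  have hmem : ∀ m t, dist (Φ t) (Φ m) ≤ Real.log (1 + s) →
      f t ∈ closedBall (f m) (s * infDist (f m) (frontier G)) := by
    intro m t ht
    rw [Real.dist_eq, hΦ] at ht
    rw [mem_closedBall, dist_comm]
    exact (hf.dist_le_mul m t).trans
      (by simpa using dist_le_mul_of_abs_integral_inv_le hg hpos hs ht)
  have hchain : dist (V (f 0)) (V (f L)) ≤
      (1 + dist (Φ 0) (Φ L) / (2 * Real.log (1 + s))) * c :=
    (isGeodesicDist_comp_continuous (intervalIntegral.continuous_primitive hint 0)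
      ).dist_le_one_add_div_mul (V := V ∘ f) (Real.log_pos (by linarith))
        (fun m _ a _ b _ ham hmb => hV.dist_le_of_mem_closedBall hG hne (hfG m) (hmem m a ham)
          (hmem m b (dist_comm (Φ m) (Φ b) ▸ hmb))) (mem_univ 0) (mem_univ L)
  have hΦL : dist (Φ 0) (Φ L) = ∫ t in 0..L, (infDist (f t) (frontier G))⁻¹ := by
    rw [dist_comm, Real.dist_eq, hΦ]
    exact abs_of_nonneg (intervalIntegral.integral_nonneg hL fun t _ => (inv_pos.2 (hpos t)).le)
  rwa [hΦL] at hchain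

theorem HasHarnackOscillation.edist_le_lintegral_path (hV : HasHarnackOscillation G s c V)
    (hG : IsOpen G) (hne : G ≠ univ) (hs : 0 < s) {γ : Path x y} (hγG : range γ ⊆ G)
    (hγ : BoundedVariationOn γ univ) :
    edist (V x) (V y) ≤
      (1 + (∫⁻ t in Icc (0 : ℝ) (eVariationOn γ univ).toReal,
        (ENNReal.ofReal (infDist (naturalParameterization γ univ 0 t) (frontier G)))⁻¹) /
          ENNReal.ofReal (2 * Real.log (1 + s))) * ENNReal.ofReal c := by
  set L := (eVariationOn γ univ).toReal
  set φ := naturalParameterization γ univ 0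
  have hL : 0 ≤ L := ENNReal.toReal_nonneg
  set f : ℝ → E := IccExtend hL ((Icc 0 L).domRestrict φ)
  have hfφ : EqOn f φ (Icc 0 L) := fun t ht => IccExtend_of_mem hL _ ht
  have hf : LipschitzWith (1 * 1) f := (lipschitzOnWith_iff_restrict.1
    (lipschitzOnWith_naturalParameterization hγ)).comp (LipschitzWith.projIcc hL)
  rw [one_mul] at hf
  have hfG : ∀ t, f t ∈ G := fun t =>
    hγG (naturalParameterization_mem_range hγ (projIcc 0 L hL t).2)
  have hpos : ∀ t, 0 < infDist (f t) (frontier G) := fun t => infDist_frontier_pos hG hne (hfG t)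
  have hchain := hV.dist_le_of_lipschitzWith hG hne hs hf hfG hL
  rw [hfφ (left_mem_Icc.2 hL), hfφ (right_mem_Icc.2 hL), show φ 0 = x from
    naturalParameterization_zero hγ, show φ L = y from naturalParameterization_length hγ] at hchain
  have hlog : 0 < 2 * Real.log (1 + s) := mul_pos two_pos (Real.log_pos (by linarith))
  have hI : 0 ≤ ∫ t in 0..L, (infDist (f t) (frontier G))⁻¹ :=
    intervalIntegral.integral_nonneg hL fun t _ => (inv_pos.2 (hpos t)).le
  have hlintegral : ∫⁻ t in Icc 0 L, (ENNReal.ofReal (infDist (φ t) (frontier G)))⁻¹ =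
      ENNReal.ofReal (∫ t in 0..L, (infDist (f t) (frontier G))⁻¹) := by
    rw [← setLIntegral_Icc_inv_ofReal (g := fun t => infDist (f t) (frontier G))
      ((continuous_infDist_pt _).comp hf.continuous) hpos hL]
    exact setLIntegral_congr_fun measurableSet_Icc fun t ht => by simp only [hfφ ht]
  rw [edist_dist, hlintegral, ← ENNReal.ofReal_div_of_pos hlog, ← ENNReal.ofReal_one,
    ← ENNReal.ofReal_add zero_le_one (by positivity), ← ENNReal.ofReal_mul (by positivity)]
  exact ENNReal.ofReal_le_ofReal hchain

theorem HasHarnackOscillation.dist_eq_zero (hV : HasHarnackOscillation G s 0 V) (hG : IsOpen G)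
    (hconn : IsPreconnected G) (hne : G ≠ univ) (hs : 0 < s) (hx : x ∈ G) (hy : y ∈ G) :
    dist (V x) (V y) = 0 := by
  refine hconn.induction₂ (fun a b => dist (V a) (V b) = 0) (fun a ha => ?_)
    (fun a b d _ _ _ hab hbd => ?_) (fun a b _ _ hab => by rwa [dist_comm]) hx hy
  · have hr : 0 < s * infDist a (frontier G) := mul_pos hs (infDist_frontier_pos hG hne ha)
    filter_upwards [mem_nhdsWithin_of_mem_nhds (closedBall_mem_nhds a hr)] with b hb
    exact (hV.dist_le_of_mem_closedBall hG hne ha (mem_closedBall_self hr.le) hb).antisymm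
      dist_nonneg
  · exact ((dist_triangle _ (V b) _).trans_eq (by rw [hab, hbd, add_zero])).antisymm dist_nonneg

theorem le_one_add_div_mul_iff {a k m c : ℝ≥0∞} (hm : m ≠ 0) (hm' : m ≠ ⊤) (hc : c ≠ 0)
    (hc' : c ≠ ⊤) : a ≤ (1 + k / m) * c ↔ (a / c - 1) * m ≤ k := by
  rw [← ENNReal.div_le_iff hc hc', ← tsub_le_iff_left,
    ENNReal.le_div_iff_mul_le (Or.inl hm) (Or.inl hm')]

theorem HasHarnackOscillation.edist_le_quasihypEDist (hV : HasHarnackOscillation G s c V)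
    (hG : IsOpen G) (hconn : IsPreconnected G) (hne : G ≠ univ) (hs : 0 < s) (hx : x ∈ G)
    (hy : y ∈ G) :
    edist (V x) (V y) ≤
      (1 + quasihypEDist G x y / ENNReal.ofReal (2 * Real.log (1 + s))) * ENNReal.ofReal c := by
  have hlog : 0 < 2 * Real.log (1 + s) := mul_pos two_pos (Real.log_pos (by linarith))
  have hc : 0 ≤ c := by
    have hself : x ∈ closedBall x (s * infDist x (frontier G)) :=
      mem_closedBall_self (mul_nonneg hs.le infDist_nonneg)
    exact dist_nonneg.trans (hV.dist_le_of_mem_closedBall hG hne hx hself hself)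
  -- The case `c = 0` is separate because `⊤ * 0 = 0` loses the bound when `quasihypEDist` is `⊤`.
  rcases hc.eq_or_lt with rfl | hc
  · simp [edist_dist, hV.dist_eq_zero hG hconn hne hs hx hy]
  have hiff : ∀ k, edist (V x) (V y) ≤
      (1 + k / ENNReal.ofReal (2 * Real.log (1 + s))) * ENNReal.ofReal c ↔ _ := fun k =>
    le_one_add_div_mul_iff (ENNReal.ofReal_pos.2 hlog).ne' ENNReal.ofReal_ne_top
      (ENNReal.ofReal_pos.2 hc).ne' ENNReal.ofReal_ne_top
  rw [hiff]
  refine le_iInf fun γ => le_iInf fun hγG => le_iInf fun hγ => ?_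
  rw [← hiff]
  exact hV.edist_le_lintegral_path hG hne hs hγG hγ

end Quasihyperbolic

end HarnackMetric

open HarnackMetric in
theorem mainTheorem8_general {E Y : Type*} [NormedAddCommGroup E] [InnerProductSpace ℝ E]
    [PseudoMetricSpace Y] {V : E → Y} {s c : ℝ} (hs : s ∈ Set.Ioo (0 : ℝ) 1) :
    (∀ G : Set E, IsOpen G → IsPreconnected G → G ≠ Set.univ → HasHarnackOscillation G s c V →
      ∀ x ∈ G, ∀ y ∈ G, edist (V x) (V y) ≤
        (1 + quasihypEDist G x y / ENNReal.ofReal (2 * Real.log (1 + s))) * ENNReal.ofReal c) ∧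
    (∀ B : GeneralizedBall E, HasHarnackOscillation B.domain s c V →
      ∀ x ∈ B.domain, ∀ y ∈ B.domain, edist (V x) (V y) ≤
        ENNReal.ofReal ((1 + B.hypDist x y / Real.log ((1 + s) / (1 - s))) * c)) :=
  ⟨fun _ hG hconn hne hV _ hx _ hy => hV.edist_le_quasihypEDist hG hconn hne hs.1 hx hy,
    fun B hV x hx y hy => (edist_dist (V x) (V y)).trans_le <|
      ENNReal.ofReal_le_ofReal (B.dist_le_one_add_hypDist_div_mul hs hV hx hy)⟩

theorem mainTheorem8 (n : ℕ) (hn : 2 ≤ n) (s C : ℝ) (hs : s ∈ Set.Ioo (0 : ℝ) 1) (hC : 1 ≤ C) :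
    (∀ G : Set (EuclideanSpace ℝ (Fin n)), HarnackMetric.IsProperSubdomain G →
      (∀ u, HarnackMetric.IsPositiveHarmonicOn G u → HarnackMetric.SatisfiesHarnack G s C u) →
      ∀ x ∈ G, ∀ y ∈ G,
        HarnackMetric.harnackDist G x y ≤
          (1 + HarnackMetric.quasihypDist G x y / ENNReal.ofReal (2 * Real.log (1 + s))) *
            ENNReal.ofReal (Real.log C)) ∧
    ((∀ u, HarnackMetric.IsPositiveHarmonicOn (HarnackMetric.unitBall n) u →
        HarnackMetric.SatisfiesHarnack (HarnackMetric.unitBall n) s C u) →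
      ∀ x ∈ HarnackMetric.unitBall n, ∀ y ∈ HarnackMetric.unitBall n,
        HarnackMetric.harnackDist (HarnackMetric.unitBall n) x y ≤
          ENNReal.ofReal ((1 + HarnackMetric.hypDistBall x y / Real.log ((1 + s) / (1 - s))) *
            Real.log C)) ∧
    ((∀ u, HarnackMetric.IsPositiveHarmonicOn (HarnackMetric.halfSpace n hn) u →
        HarnackMetric.SatisfiesHarnack (HarnackMetric.halfSpace n hn) s C u) →
      ∀ x ∈ HarnackMetric.halfSpace n hn, ∀ y ∈ HarnackMetric.halfSpace n hn,
        HarnackMetric.harnackDist (HarnackMetric.halfSpace n hn) x y ≤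
          ENNReal.ofReal ((1 + HarnackMetric.hypDistHalfSpace hn x y /
            Real.log ((1 + s) / (1 - s))) * Real.log C)) := by
  open HarnackMetric GeneralizedBall in
  refine ⟨fun G hG hH x hx y hy => ?_, fun hH x hx y hy => ?_, fun hH x hx y hy => ?_⟩ <;>
    refine harnackDist_le_of_forall_hasHarnackOscillation hs.2 hH hx hy fun V hV => ?_
  · rw [quasihypDist_eq_quasihypEDist]
    exact (mainTheorem8_general hs).1 G hG.1 hG.2.1.isPreconnected hG.2.2 hV x hx y hy
  · have hdist : _ = hypDistBall x y := hypDist_unitBall hx hy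
    rw [HarnackMetric.unitBall, ← domain_unitBall] at hV hx hy
    exact hdist ▸ (mainTheorem8_general hs).2 _ hV x hx y hy
  · rw [← domain_coordHalfSpace hn] at hV hx hy
    exact hypDist_coordHalfSpace hn x y ▸ (mainTheorem8_general hs).2 _ hV x hx y hy
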